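/- Let $G$ and $H$ be Polish groups, let $X$ be a Polish $G$-space and $Y$ a Polish $H$-space (Polish spaces with continuous actions), and write $E_G^X$, $E_H^Y$ for the orbit equivalence relations. For points $x,y\in X$, the Becker-embedding game $\mathrm{Emb}(x,y)$ is played as follows. Set $V_0=G$. In turn $n\ge 1$, Player I plays an open neighborhood $U_n$ of $x$ in $X$ and an open neighborhood $V_n$ of the identity of $G$, and Player II replies with an element $g_{n-1}\in V_{n-1}$. Player II wins if $g_{n-1}\cdots g_0\,y\in U_n$ for every $n\ge 1$. The point $x$ is \emph{Becker embeddable} into $y$, written $x\preccurlyeq_{\mathcal B}y$, if Player II has a winning strategy in $\mathrm{Emb}(x,y)$. This relation depends only on the orbits $[x]$ and $[y]$. The \emph{Becker digraph} $\mathcal B(X/G)$ has the $G$-orbits of points of $X$ as vertices, with an arrow from $[x]$ to $[y]$ if and only if $x\preccurlyeq_{\mathcal B}y$; for a $G$-invariant set $X_0\subseteq X$, $\mathcal B(X_0/G)$ is the subgraph induced on the orbits contained in $X_0$. The same notions are used for $H$ and $Y$. Let $f:X\to Y$ be a Baire-measurable $(E_G^X,E_H^Y)$-homomorphism; that is, the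 preimage under $f$ of every open set has the property of Baire, and $f$ maps points in the same $G$-orbit to points in the same $H$-orbit. Then there exists a $G$-invariant dense $G_\delta$ subset $X_0$ of $X$ such that for all $x,y\in X_0$, if $x\preccurlyeq_{\mathcal B}y$ then $f(x)\preccurlyeq_{\mathcal B}f(y)$. Equivalently, the map $[f]:X_0/G\to Y/H$, $[x]\mapsto[f(x)]$, is a digraph homomorphism from the Becker digraph $\mathcal B(X_0/G)$ to the Becker digraph $\mathcal B(Y/H)$. -/

import Mathlib

namespace BeckerGame

open TopologicalSpace

section Game

variable (G : Type*) {X : Type*} [Group G] [TopologicalSpace G] [TopologicalSpace X]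
  [MulAction G X]

/-- A move of Player I in the game `Emb(x, y)`: an open neighborhood of `x` in `X` together with
an open neighborhood of the identity in `G`. -/
abbrev Move (x : X) : Type _ := OpenNhdsOf x × OpenNhdsOf (1 : G)

/-- A strategy of Player II in `Emb(x, y)`: the element `g_n` is computed from the first `n + 1`
moves `(U_1, V_1), …, (U_{n+1}, V_{n+1})` of Player I. -/
abbrev Strategy (x : X) : Type _ := (n : ℕ) → (Fin (n + 1) → Move G x) → G

variable {G}

/-- The sequence `g_0, g_1, …` that Player II plays when following the strategy `σ` against the
moves `m` of Player I; here `m n = (U_{n+1}, V_{n+1})`. -/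
def Strategy.play {x : X} (σ : Strategy G x) (m : ℕ → Move G x) (n : ℕ) : G :=
  σ n (fun i => m i)

/-- The product `g_{n-1} ⋯ g_1 g_0`. -/
def prodUpTo (g : ℕ → G) : ℕ → G
  | 0 => 1
  | n + 1 => g n * prodUpTo g n

/-- The set `V_n` from which Player II has to choose `g_n`: it is all of `G` for `n = 0`, and the
neighborhood of the identity played by Player I in the `n`-th turn for `n ≥ 1`. -/
def allowed {x : X} (m : ℕ → Move G x) : ℕ → Set G
  | 0 => Set.univ
  | n + 1 => (m n).2

/-- The strategy `σ` of Player II is winning in `Emb(x, y)`: in every run in which Player II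
follows `σ`, all her moves are legal (`g_n ∈ V_n` for every `n`), and
`g_{n-1} ⋯ g_0 y ∈ U_n` for every `n ≥ 1`. -/
def Strategy.IsWinning {x : X} (σ : Strategy G x) (y : X) : Prop :=
  ∀ m : ℕ → Move G x,
    (∀ n, σ.play m n ∈ allowed m n) ∧ (∀ n, prodUpTo (σ.play m) (n + 1) • y ∈ (m n).1)

variable (G)

/-- `x` is Becker embeddable into `y`: Player II has a winning strategy in the game
`Emb(x, y)`. -/
def BeckerEmbeddable (x y : X) : Prop :=
  ∃ σ : Strategy G x, σ.IsWinning y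

end Game

section Digraph

variable (G : Type*) {X : Type*} [Group G] [TopologicalSpace G] [IsTopologicalGroup G]
  [TopologicalSpace X] [MulAction G X] [ContinuousSMul G X]

/-- Becker embeddability depends only on the orbits of the two points (one direction). -/
theorem BeckerEmbeddable.smul {x y : X} (hxy : BeckerEmbeddable G x y) (a b : G) :
    BeckerEmbeddable G (a • x) (b • y) := by
  obtain ⟨σ, hσ⟩ := hxy
  let T : Move G (a • x) → Move G x := fun p =>
    (⟨⟨(fun z : X => a • z) ⁻¹' p.1, p.1.isOpen.preimage (continuous_const_smul a)⟩, p.1.mem⟩,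
     ⟨⟨(fun k : G => a * k * a⁻¹) ⁻¹' p.2, p.2.isOpen.preimage (by fun_prop)⟩, by
        have h : (1 : G) ∈ (p.2 : Set G) := p.2.mem
        simpa using h⟩)
  let τ : Strategy G (a • x) := fun n q =>
    match n, q with
    | 0, q => a * σ 0 (fun i => T (q i)) * b⁻¹
    | n + 1, q => a * σ (n + 1) (fun i => T (q i)) * a⁻¹
  refine ⟨τ, fun m => ?_⟩
  obtain ⟨h1, h2⟩ := hσ (fun n => T (m n))
  have hp : ∀ n, prodUpTo (τ.play m) (n + 1)
      = a * prodUpTo (σ.play fun n => T (m n)) (n + 1) * b⁻¹ := by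
    intro n
    induction n with
    | zero => simp [prodUpTo, Strategy.play, τ]
    | succ n ih =>
      rw [prodUpTo, ih]
      change a * σ.play (fun n => T (m n)) (n + 1) * a⁻¹ * _
        = a * (σ.play (fun n => T (m n)) (n + 1) * _) * b⁻¹
      simp [mul_assoc]
  refine ⟨fun n => ?_, fun n => ?_⟩
  · cases n with
    | zero => exact Set.mem_univ _
    | succ n => exact h1 (n + 1)
  · rw [hp]
    have h : a • (prodUpTo (σ.play fun n => T (m n)) (n + 1) • y) ∈ ((m n).1 : Set X) := h2 n
    simpa [mul_smul] using h

/-- Becker embeddability depends only on the orbits of the two points. -/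
theorem beckerEmbeddable_congr {x y x' y' : X} (hx : MulAction.orbitRel G X x x')
    (hy : MulAction.orbitRel G X y y') :
    BeckerEmbeddable G x y = BeckerEmbeddable G x' y' := by
  obtain ⟨a, rfl⟩ := hx
  obtain ⟨b, rfl⟩ := hy
  refine propext ⟨fun h => ?_, fun h => h.smul G a b⟩
  simpa using h.smul G a⁻¹ b⁻¹

variable (X)

/-- The Becker digraph `B(X/G)`: its vertices are the `G`-orbits of points of `X`, and there is an
arrow from `[x]` to `[y]` if and only if `x` is Becker embeddable into `y`. -/
def beckerDigraph : Digraph (MulAction.orbitRel.Quotient G X) where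
  Adj := Quotient.lift₂ (s₁ := MulAction.orbitRel G X) (s₂ := MulAction.orbitRel G X)
    (fun x y => BeckerEmbeddable G x y) (fun _ _ _ _ hx hy => beckerEmbeddable_congr G hx hy)

variable {X}

/-- The set `X₀/G` of the orbits of points of `X₀`, as a subset of `X/G`. -/
def orbitsOf (X₀ : Set X) : Set (MulAction.orbitRel.Quotient G X) :=
  Quotient.mk (MulAction.orbitRel G X) '' X₀

/-- The Becker digraph `B(X₀/G)`: the subgraph of `B(X/G)` induced on the orbits from `X₀`. -/
def beckerDigraphOn (X₀ : Set X) : Digraph (orbitsOf G X₀) where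
  Adj a b := (beckerDigraph G X).Adj a b

end Digraph

/-- `φ` is a homomorphism of digraphs: it maps arrows to arrows. -/
def IsDigraphHom {V W : Type*} (D : Digraph V) (D' : Digraph W) (φ : V → W) : Prop :=
  ∀ a b, D.Adj a b → D'.Adj (φ a) (φ b)

/-- `f` is Baire measurable: preimages of open sets have the property of Baire. -/
def BaireMeasurable {X Y : Type*} [TopologicalSpace X] [TopologicalSpace Y] (f : X → Y) : Prop :=
  ∀ U : Set Y, IsOpen U → BaireMeasurableSet (f ⁻¹' U)

section Hom

variable (G H : Type*) {X Y : Type*} [Group G] [Group H] [MulAction G X] [MulAction H Y]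

/-- `f` is an `(E_G^X, E_H^Y)`-homomorphism: points in the same `G`-orbit are mapped to points in
the same `H`-orbit. -/
def IsOrbitHom (f : X → Y) : Prop :=
  ∀ x x' : X, MulAction.orbitRel G X x x' → MulAction.orbitRel H Y (f x) (f x')

variable {G H}

/-- The map `[f] : X/G → Y/H`, `[x] ↦ [f x]` induced by an orbit homomorphism `f`. -/
def IsOrbitHom.orbitMap {f : X → Y} (hf : IsOrbitHom G H f) :
    MulAction.orbitRel.Quotient G X → MulAction.orbitRel.Quotient H Y :=
  Quotient.map (sa := MulAction.orbitRel G X) (sb := MulAction.orbitRel H Y) f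
    (fun x x' h => hf x x' h)

end Hom

end BeckerGame

/-! The key is an orbit continuity lemma: there is a comeagre `Gδ` set `C` on which `f` is
continuous and such that, for `W` a neighborhood of `1` in `H`, locally uniformly in `x ∈ C`,
generic `v` near `1` in `G` satisfy `f (v • x) ∈ W • f x` (`exists_orbit_continuity`). It follows
from Kuratowski–Ulam and the Baire property of analytic sets, applied to the relation `f (g • x) ∈ W
• f x`.

Take for `X₀` the points whose generic translates lie in `C`. In `Emb(f x, f y)` with `x ∈ C`,
Player II translates each move into a move of `Emb(x, y)`, lets the given strategy answer, and
perturbs the resulting position by a generic small `k` so that it lands in `C`. Continuity of `f`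
keeps its image in the prescribed neighborhood of `f x`; orbit continuity supplies small elements of
`H` linking successive images. -/

namespace BeckerGame

open TopologicalSpace Filter Topology Set MeasureTheory

/-! ### Baire category: analytic sets, Kuratowski–Ulam, category quantifiers. -/

section Category

variable {X G : Type*} [TopologicalSpace X] [TopologicalSpace G]

/-- The points near which `A` is locally nonmeagre. -/
def nonmeagreLocus (A : Set X) : Set X := {x | ∀ U : Set X, IsOpen U → x ∈ U → ¬ IsMeagre (A ∩ U)}

theorem isClosed_nonmeagreLocus (A : Set X) : IsClosed (nonmeagreLocus A) := by
  rw [← isOpen_compl_iff, isOpen_iff_forall_mem_open]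
  intro x hx
  simp only [nonmeagreLocus, mem_compl_iff, mem_ofPred_eq, not_forall, not_not] at hx
  obtain ⟨U, hU, hxU, hm⟩ := hx
  exact ⟨U, fun z hz hzA => hzA U hU hz hm, hU, hxU⟩

theorem nonmeagreLocus_subset_closure (A : Set X) : nonmeagreLocus A ⊆ closure A := by
  intro x hx
  by_contra h
  refine hx (closure A)ᶜ isClosed_closure.isOpen_compl h ?_
  have : A ∩ (closure A)ᶜ = ∅ := by
    rw [← sdiff_eq, sdiff_eq_empty]
    exact subset_closure
  rw [this]
  exact IsMeagre.empty

theorem isMeagre_diff_nonmeagreLocus [SecondCountableTopology X] (A : Set X) :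
    IsMeagre (A \ nonmeagreLocus A) := by
  have h : IsMeagre (⋃ U ∈ {U ∈ countableBasis X | IsMeagre (A ∩ U)}, A ∩ U) :=
    isMeagre_biUnion ((countable_countableBasis X).mono (sep_subset _ _)) fun U hU => hU.2
  refine h.mono ?_
  rintro x ⟨hxA, hx⟩
  simp only [nonmeagreLocus, mem_ofPred_eq, not_forall, not_not] at hx
  obtain ⟨U, hU, hxU, hm⟩ := hx
  obtain ⟨B, hB, hxB, hBU⟩ := (isBasis_countableBasis X).exists_subset_of_mem_open hxU hU
  exact mem_biUnion (show B ∈ {U ∈ countableBasis X | IsMeagre (A ∩ U)} from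
    ⟨hB, hm.mono (inter_subset_inter_right _ hBU)⟩) ⟨hxA, hxB⟩

/-- Otherwise the difference would be comeagre in a nonempty open set, where `A` would then be
meagre; but such an open set misses the locus. So the locus is a minimal Baire-measurable hull
modulo meagre sets. -/
theorem isMeagre_nonmeagreLocus_diff {A B : Set X} (hB : BaireMeasurableSet B)
    (hAB : IsMeagre (A \ B)) : IsMeagre (nonmeagreLocus A \ B) := by
  obtain ⟨O, hO, hEO⟩ :=
    ((isClosed_nonmeagreLocus A).isOpen_compl.baireMeasurableSet.of_compl.diff hB).residualEq_isOpen
  rw [eventuallyEq_set] at hEO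
  have hdisj : ∀ x ∈ O, x ∉ nonmeagreLocus A := by
    intro x hxO hx
    refine hx O hO hxO ?_
    change _ ∈ residual X
    filter_upwards [hEO, hAB] with z hz hz' hzA
    exact hz' ⟨hzA.1, (hz.2 hzA.2).2⟩
  change _ ∈ residual X
  filter_upwards [hEO] with z hz hzE
  exact hdisj z (hz.1 hzE) hzE.1

/-- Analytic sets have the property of Baire. -/
theorem _root_.MeasureTheory.AnalyticSet.baireMeasurableSet [SecondCountableTopology X] [T3Space X]
    {A : Set X} (hA : AnalyticSet A) : BaireMeasurableSet A := by
  rw [AnalyticSet] at hA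
  rcases hA with rfl | ⟨φ, hφ, rfl⟩
  · exact IsMeagre.empty.baireMeasurableSet
  let S : List ℕ → Set X := fun l => φ '' {α | PiNat.res α l.length = l}
  have hS : ∀ l, IsMeagre (S l \ ⋃ n, nonmeagreLocus (S (n :: l))) := by
    intro l
    refine (isMeagre_iUnion fun n => isMeagre_diff_nonmeagreLocus (S (n :: l))).mono ?_
    rintro _ ⟨⟨α, hα, rfl⟩, hx⟩
    refine mem_iUnion.2 ⟨α l.length, ⟨α, ?_, rfl⟩, fun h => hx (mem_iUnion.2 ⟨_, h⟩)⟩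
    have hα' : PiNat.res α l.length = l := hα
    simp [PiNat.res_succ, hα']
  have hE : ∀ l, IsMeagre (nonmeagreLocus (S l) \ ⋃ n, nonmeagreLocus (S (n :: l))) := fun l =>
    isMeagre_nonmeagreLocus_diff (BaireMeasurableSet.iUnion fun n =>
      (isClosed_nonmeagreLocus _).isOpen_compl.baireMeasurableSet.of_compl) (hS l)
  have hE' := isMeagre_iUnion hE
  have hS0 : S [] = range φ := by simp [S]
  have h0 := isMeagre_diff_nonmeagreLocus (S [])
  refine (isClosed_nonmeagreLocus (S [])).isOpen_compl.baireMeasurableSet.of_compl.congr ?_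
  rw [eventuallyEq_set]
  filter_upwards [hE', h0] with x hx hx0
  refine ⟨fun hxE => ?_, fun hxφ => ?_⟩
  -- Off a meagre set, membership in a hull passes to some child in the Souslin scheme. The branch
  -- so followed is an `α` with `φ α = x`, since `x` lies in the closure of every `S (L n)`.
  · have hstep : ∀ l, x ∈ nonmeagreLocus (S l) → ∃ n, x ∈ nonmeagreLocus (S (n :: l)) := by
      intro l hl
      by_contra h
      exact hx (mem_iUnion.2 ⟨l, hl, fun h' => h (mem_iUnion.1 h')⟩)
    choose! nxt hnxt using hstep
    let L : ℕ → List ℕ := fun n => Nat.rec [] (fun _ l => nxt l :: l) n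
    have hL : ∀ n, x ∈ nonmeagreLocus (S (L n)) := by
      intro n
      induction n with
      | zero => exact hxE
      | succ n ih => exact hnxt _ ih
    let α : ℕ → ℕ := fun n => nxt (L n)
    have hLα : ∀ n, PiNat.res α n = L n := by
      intro n
      induction n with
      | zero => rfl
      | succ n ih => rw [PiNat.res_succ, ih]
    refine ⟨α, ?_⟩
    by_contra hne
    obtain ⟨U, V, hU, hV, hUV⟩ := t2_separation_nhds hne
    obtain ⟨V', hV', hV'c, hV'U⟩ := exists_mem_nhds_isClosed_subset hU
    have hx' : x ∉ V' := fun h => disjoint_left.1 hUV (hV'U h) (mem_of_mem_nhds hV)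
    have := hφ.continuousAt hV'
    obtain ⟨_, ⟨β, n, rfl⟩, hαβ, hsub⟩ := (PiNat.isTopologicalBasis_cylinders
      (fun _ : ℕ => ℕ)).mem_nhds_iff.1 this
    refine hx' (closure_minimal ?_ hV'c (nonmeagreLocus_subset_closure _ (hL n)))
    rintro _ ⟨γ, hγ, rfl⟩
    apply hsub
    have hγ' : PiNat.res γ (L n).length = L n := hγ
    rw [← hLα n, PiNat.res_length] at hγ'
    exact fun i hi => (PiNat.res_eq_res.1 hγ' hi).trans (hαβ i hi)
  · by_contra h
    exact hx0 ⟨hS0 ▸ hxφ, h⟩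

/-- One direction of the Kuratowski–Ulam theorem. -/
theorem eventually_residual_prod [SecondCountableTopology G] {p : X × G → Prop}
    (h : ∀ᶠ z in residual (X × G), p z) :
    ∀ᶠ x in residual X, ∀ᶠ g in residual G, p (x, g) := by
  obtain ⟨S, hSo, hSd, hSc, hS⟩ := mem_residual_iff.1 h
  have h1 : ∀ t ∈ S, ∀ B ∈ countableBasis G, ∀ᶠ x in residual X, ∃ g ∈ B, (x, g) ∈ t := by
    intro t ht B hB
    have hBo := isOpen_of_mem_countableBasis hB
    refine residual_of_dense_open ?_ ?_
    · have : {x | ∃ g ∈ B, (x, g) ∈ t} = Prod.fst '' (t ∩ univ ×ˢ B) := by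
        ext x
        simp [and_comm]
      change IsOpen {x | ∃ g ∈ B, (x, g) ∈ t}
      rw [this]
      exact isOpenMap_fst _ ((hSo t ht).inter (isOpen_univ.prod hBo))
    · rw [dense_iff_inter_open]
      intro U hU hUne
      obtain ⟨z, hz, hzt⟩ := (hSd t ht).inter_open_nonempty _ (hU.prod hBo)
        (hUne.prod (nonempty_of_mem_countableBasis hB))
      exact ⟨z.1, hz.1, z.2, hz.2, hzt⟩
  have h2 : ∀ᶠ x in residual X, ∀ t ∈ S, ∀ B ∈ countableBasis G, ∃ g ∈ B, (x, g) ∈ t :=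
    (eventually_countable_ball hSc).2 fun t ht =>
      (eventually_countable_ball (countable_countableBasis G)).2 fun B hB => h1 t ht B hB
  filter_upwards [h2] with x hx
  have h3 : ∀ᶠ g in residual G, ∀ t ∈ S, (x, g) ∈ t := by
    refine (eventually_countable_ball hSc).2 fun t ht => residual_of_dense_open
      ((hSo t ht).preimage (by fun_prop : Continuous fun g : G => (x, g))) ?_
    rw [(isBasis_countableBasis G).dense_iff]
    intro B hB _
    obtain ⟨g, hg, hgt⟩ := hx t ht B hB
    exact ⟨g, hg, hgt⟩
  filter_upwards [h3] with g hg
  exact hS (mem_sInter.2 hg)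

theorem exists_mem_of_eventually_residual [BaireSpace X] {p : X → Prop} {U : Set X}
    (hU : IsOpen U) (hne : U.Nonempty) (h : ∀ᶠ x in residual X, p x) : ∃ x ∈ U, p x :=
  (dense_of_mem_residual h).inter_open_nonempty U hU hne

/-- An open set is comeagre in `V` exactly when it is dense in `V`, which basic open sets test by
countably many conditions. -/
theorem eventually_residual_imp_iff [SecondCountableTopology G] [BaireSpace G] {O V : Set G}
    (hO : IsOpen O) (hV : IsOpen V) : (∀ᶠ g in residual G, g ∈ V → g ∈ O) ↔
      ∀ B ∈ countableBasis G, B ⊆ V → ∃ g ∈ B, g ∈ O := by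
  refine ⟨fun h B hB hBV => ?_, fun h => ?_⟩
  · obtain ⟨g, hg, hgO⟩ := exists_mem_of_eventually_residual (isOpen_of_mem_countableBasis hB)
      (nonempty_of_mem_countableBasis hB) h
    exact ⟨g, hg, hgO (hBV hg)⟩
  · filter_upwards [eventuallyEq_set.1 (closure_residualEq hO.isLocallyClosed)] with g hg hgV
    rw [← hg, (isBasis_countableBasis G).mem_closure_iff]
    intro B hB hgB
    obtain ⟨B', hB', hgB', hsub⟩ := (isBasis_countableBasis G).exists_subset_of_mem_open
      (show g ∈ B ∩ V from ⟨hgB, hgV⟩) ((isOpen_of_mem_countableBasis hB).inter hV)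
    obtain ⟨k, hk, hkO⟩ := h B' hB' fun z hz => (hsub hz).2
    exact ⟨k, (hsub hk).1, hkO⟩

/-- The category quantifier preserves the property of Baire. -/
theorem baireMeasurableSet_forall_residual [SecondCountableTopology G] [BaireSpace G]
    {R : Set (X × G)} (hR : BaireMeasurableSet R) {V : Set G} (hV : IsOpen V) :
    BaireMeasurableSet {x : X | ∀ᶠ g in residual G, g ∈ V → (x, g) ∈ R} := by
  obtain ⟨O, hO, hRO⟩ := hR.residualEq_isOpen
  have hT : BaireMeasurableSet
      (⋂ B ∈ {B ∈ countableBasis G | B ⊆ V}, {x : X | ∃ g ∈ B, (x, g) ∈ O}) := by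
    refine BaireMeasurableSet.biInter ((countable_countableBasis G).mono (sep_subset _ _)) ?_
    intro B _
    have : {x : X | ∃ g ∈ B, (x, g) ∈ O} = ⋃ g ∈ B, (fun x => (x, g)) ⁻¹' O := by
      ext x
      simp
    rw [this]
    exact (isOpen_biUnion fun g _ => hO.preimage (by fun_prop)).baireMeasurableSet
  refine hT.congr ?_
  rw [eventuallyEq_set]
  filter_upwards [eventually_residual_prod (eventuallyEq_set.1 hRO)] with x hx
  have h1 : (∀ᶠ g in residual G, g ∈ V → (x, g) ∈ R) ↔
      ∀ᶠ g in residual G, g ∈ V → g ∈ (fun g : G => (x, g)) ⁻¹' O :=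
    eventually_congr (by filter_upwards [hx] with g hg; rw [hg]; rfl)
  change _ ↔ ∀ᶠ g in residual G, g ∈ V → (x, g) ∈ R
  rw [h1, eventually_residual_imp_iff (hO.preimage (by fun_prop)) hV]
  simp

theorem BaireMeasurable.exists_continuousOn [BaireSpace X] {Y : Type*} [TopologicalSpace Y]
    [SecondCountableTopology Y] {f : X → Y} (hf : BaireMeasurable f) :
    ∃ C ∈ residual X, IsGδ C ∧ ContinuousOn f C := by
  choose! O hO hfO using fun (U : Set Y) (hU : IsOpen U) => (hf U hU).residualEq_isOpen
  have h : ∀ᶠ x in residual X, ∀ B ∈ countableBasis Y, x ∈ f ⁻¹' B ↔ x ∈ O B :=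
    (eventually_countable_ball (countable_countableBasis Y)).2 fun B hB =>
      eventuallyEq_set.1 (hfO B (isOpen_of_mem_countableBasis hB))
  obtain ⟨C, hC, hCG, hCd⟩ := mem_residual.1 h
  refine ⟨C, residual_of_dense_Gδ hCG hCd, hCG, fun x hx => ?_⟩
  rw [ContinuousWithinAt, (isBasis_countableBasis Y).nhds_hasBasis.tendsto_right_iff]
  rintro B ⟨hB, hxB⟩
  filter_upwards [self_mem_nhdsWithin, mem_nhdsWithin_of_mem_nhds
    ((hO B (isOpen_of_mem_countableBasis hB)).mem_nhds ((hC hx B hB).1 hxB))] with z hzC hzO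
  exact (hC hzC B hB).2 hzO

end Category

end BeckerGame

namespace BeckerGame

open TopologicalSpace Filter Topology Set MeasureTheory

/-! ### Generic translates under a continuous action. -/

section Action

variable {G X : Type*} [Group G] [TopologicalSpace G] [TopologicalSpace X] [MulAction G X]
  [ContinuousSMul G X]

theorem eventually_residual_mul_right [IsTopologicalGroup G] {p : G → Prop} (h : ∀ᶠ g in residual G, p g) (a : G) :
    ∀ᶠ g in residual G, p (g * a) :=
  (tendsto_residual_of_isOpenMap (continuous_mul_const a) (isOpenMap_mul_right a)).eventually h

theorem eventually_residual_smul {p : X → Prop} (h : ∀ᶠ x in residual X, p x) :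
    ∀ᶠ z in residual (X × G), p (z.2 • z.1) := by
  refine (tendsto_residual_of_isOpenMap (f := fun z : X × G => z.2 • z.1) (by fun_prop)
    -- The action map is open because a continuous section passes through each point.
    (IsOpenMap.of_sections fun z => ⟨fun y => (z.2⁻¹ • y, z.2), ?_, ?_, ?_⟩)).eventually h
  · exact (by fun_prop : Continuous fun y : X => (z.2⁻¹ • y, z.2)).continuousAt
  · simp
  · intro y
    simp

/-- If the complement of `E` were comeagre in a nonempty open `O`, then for generic `x ∈ O` a
generic `g` near `1` would put `g • x` both in and outside `E`. -/
theorem eventually_residual_of_smul [SecondCountableTopology G] [BaireSpace G] [BaireSpace X]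
    {E : Set X} (hE : BaireMeasurableSet E)
    (h : ∀ᶠ x in residual X, ∀ᶠ g in residual G, g • x ∈ E) : ∀ᶠ x in residual X, x ∈ E := by
  obtain ⟨O, hO, hEO⟩ := hE.compl.residualEq_isOpen
  rw [eventuallyEq_set] at hEO
  have hempty : O = ∅ := by
    by_contra hne
    obtain ⟨x, hxO, hx, hx'⟩ := exists_mem_of_eventually_residual hO
      (nonempty_iff_ne_empty.2 hne)
      (h.and (eventually_residual_prod (eventually_residual_smul (G := G) hEO)))
    obtain ⟨g, hg, hgE, hgO⟩ := exists_mem_of_eventually_residual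
      (hO.preimage (by fun_prop : Continuous fun g : G => g • x)) ⟨1, by simpa using hxO⟩
      (hx.and hx')
    exact hgO.2 hg hgE
  filter_upwards [hEO] with x hx
  by_contra hxE
  simpa [hempty] using hx.1 hxE

/-- The Vaught transform of a `Gδ` set is `Gδ`. -/
theorem isGδ_eventually_smul_mem [SecondCountableTopology G] [BaireSpace G] {C : Set X}
    (hC : IsGδ C) :
    IsGδ {x : X | ∀ᶠ g in residual G, g • x ∈ C} := by
  obtain ⟨O, hO, rfl⟩ := hC.eq_iInter_nat
  have : {x : X | ∀ᶠ g in residual G, g • x ∈ ⋂ n, O n} =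
      ⋂ n, ⋂ B ∈ countableBasis G, {x : X | ∃ g ∈ B, g • x ∈ O n} := by
    ext x
    have h : ∀ n, (∀ᶠ g in residual G, g • x ∈ O n) ↔
        ∀ B ∈ countableBasis G, ∃ g ∈ B, g • x ∈ O n := fun n => by
      simpa using eventually_residual_imp_iff (V := univ)
        ((hO n).preimage (by fun_prop : Continuous fun g : G => g • x)) isOpen_univ
    simp only [mem_iInter]
    exact eventually_countable_forall.trans (forall_congr' h)
  rw [this]
  refine IsGδ.iInter fun n => IsGδ.biInter_of_isOpen (countable_countableBasis G) fun B _ => ?_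
  have : {x : X | ∃ g ∈ B, g • x ∈ O n} = ⋃ g ∈ B, (fun x => g • x) ⁻¹' O n := by
    ext x
    simp
  rw [this]
  exact isOpen_biUnion fun g _ => (hO n).preimage (by fun_prop)

end Action

/-! ### Orbit continuity of Baire-measurable homomorphisms. -/

section Homomorphism

variable {G H X Y : Type*}
    [Group G] [TopologicalSpace G] [PolishSpace G]
    [Group H] [TopologicalSpace H] [PolishSpace H]
    [TopologicalSpace X] [PolishSpace X] [MulAction G X] [ContinuousSMul G X]
    [TopologicalSpace Y] [PolishSpace Y] [MulAction H Y] [ContinuousSMul H Y]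

/-- Replacing `f` by a Borel map equal to it on a comeagre set changes the relation only on a meagre
set and makes it a projection of a Borel set, hence analytic. -/
theorem baireMeasurableSet_smul_relation {f : X → Y} (hf : BaireMeasurable f) {W : Set H}
    (hW : IsOpen W) :
    BaireMeasurableSet {z : X × G | ∃ w ∈ W, f (z.2 • z.1) = w • f z.1} := by
  classical
  borelize X Y G H
  obtain ⟨C, hC, hCG, hfC⟩ := hf.exists_continuousOn
  rcases isEmpty_or_nonempty X with hX | ⟨⟨x₀⟩⟩
  · rw [show {z : X × G | ∃ w ∈ W, f (z.2 • z.1) = w • f z.1} = ∅ from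
      eq_empty_of_forall_notMem fun z => (hX.false z.1).elim]
    exact isOpen_empty.baireMeasurableSet
  let f' : X → Y := C.piecewise f fun _ => f x₀
  have hf' : Measurable f' :=
    hfC.measurable_piecewise continuousOn_const hCG.measurableSet
  have hff' : ∀ x ∈ C, f' x = f x := fun x hx => piecewise_eq_of_mem _ _ _ hx
  have hT : MeasurableSet {t : (X × G) × H | t.2 ∈ W ∧ f' (t.1.2 • t.1.1) = t.2 • f' t.1.1} := by
    refine (measurable_snd hW.measurableSet).inter (measurableSet_eq_fun ?_ ?_)
    · exact hf'.comp (by fun_prop : Continuous fun t : (X × G) × H => t.1.2 • t.1.1).measurable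
    · exact (by fun_prop : Continuous fun q : H × Y => q.1 • q.2).measurable.comp
        (measurable_snd.prodMk (hf'.comp (measurable_fst.comp measurable_fst)))
  refine (hT.analyticSet_image measurable_fst).baireMeasurableSet.congr ?_
  rw [eventuallyEq_set]
  filter_upwards [eventually_residual_smul (G := G) (p := (· ∈ C)) hC,
    (tendsto_residual_of_isOpenMap (α := X × G) continuous_fst isOpenMap_fst).eventually
      (p := (· ∈ C)) hC] with z hz hz'
  simp [hff' _ hz, hff' _ hz']

/-- Countably many translates `W₀ * d i` cover `H`, and each associated relation is open modulo
meagre. So generic `v` near `1` keep the transporting element in the translate used at `g`, and two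
elements of one translate differ by an element of `W₀ * W₀⁻¹ ⊆ W`. -/
theorem eventually_locally_controlled [IsTopologicalGroup G] [IsTopologicalGroup H] {f : X → Y}
    (hmeas : BaireMeasurable f)
    (hf : IsOrbitHom G H f) {W : Set H} (hW : W ∈ 𝓝 (1 : H)) :
    ∀ᶠ x in residual X, ∀ᶠ g in residual G, ∃ V ∈ 𝓝 (1 : G),
      ∀ᶠ v in residual G, v ∈ V → ∃ w ∈ W, f (v • g • x) = w • f (g • x) := by
  obtain ⟨W', hW', hWW'⟩ := exists_nhds_split_inv hW
  obtain ⟨W₀, hW₀, hW₀o, h1⟩ := mem_nhds_iff.1 hW'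
  let d : ℕ → H := denseSeq H
  have hcover : ∀ h : H, ∃ i, h * (d i)⁻¹ ∈ W₀ := by
    intro h
    obtain ⟨_, hi, i, rfl⟩ := (denseRange_denseSeq H).inter_open_nonempty
      ((fun k => h * k⁻¹) ⁻¹' W₀) (hW₀o.preimage (by fun_prop)) ⟨h, by simpa using h1⟩
    exact ⟨i, hi⟩
  have hR := fun i => (baireMeasurableSet_smul_relation (G := G) hmeas
    (hW₀o.preimage (by fun_prop : Continuous fun h : H => h * (d i)⁻¹))).residualEq_isOpen
  choose O hO hRO using hR
  have h2 : ∀ᶠ z in residual (X × G), ∀ i,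
      (∃ w, w * (d i)⁻¹ ∈ W₀ ∧ f (z.2 • z.1) = w • f z.1) ↔ z ∈ O i :=
    eventually_countable_forall.2 fun i => eventuallyEq_set.1 (hRO i)
  filter_upwards [eventually_residual_prod h2] with x hx
  filter_upwards [hx] with g hg
  obtain ⟨h, hh⟩ : ∃ h : H, h • f x = f (g • x) := hf (g • x) x ⟨g, rfl⟩
  obtain ⟨i, hi⟩ := hcover h
  have hgO : (x, g) ∈ O i := (hg i).1 ⟨h, hi, hh.symm⟩
  refine ⟨{v | (x, v * g) ∈ O i}, ((hO i).preimage
    (by fun_prop : Continuous fun v : G => (x, v * g))).mem_nhds (by simpa using hgO), ?_⟩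
  filter_upwards [eventually_residual_mul_right hx g] with v hv hvO
  obtain ⟨h', hi', hh'⟩ := (hv i).2 hvO
  refine ⟨h' * h⁻¹, ?_, ?_⟩
  · simpa [div_eq_mul_inv] using hWW' _ (hW₀ hi') _ (hW₀ hi)
  · rw [← hh, smul_smul v, smul_smul _ h, inv_mul_cancel_right, hh']

/-- The orbit continuity lemma. -/
theorem exists_orbit_continuity [IsTopologicalGroup G] [IsTopologicalGroup H] {f : X → Y}
    (hmeas : BaireMeasurable f)
    (hf : IsOrbitHom G H f) :
    ∃ C ∈ residual X, IsGδ C ∧ ContinuousOn f C ∧ ∀ W ∈ 𝓝 (1 : H), ∀ x₀ ∈ C,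
      ∃ U ∈ 𝓝 x₀, ∃ V ∈ 𝓝 (1 : G), ∀ x ∈ C ∩ U,
        ∀ᶠ v in residual G, v ∈ V → ∃ w ∈ W, f (v • x) = w • f x := by
  obtain ⟨W, hW⟩ := (𝓝 (1 : H)).exists_antitone_basis
  obtain ⟨V, hV⟩ := (𝓝 (1 : G)).exists_antitone_basis
  obtain ⟨C₀, hC₀, -, hfC₀⟩ := hmeas.exists_continuousOn
  let E : ℕ → ℕ → Set X := fun i j => {x | ∀ᶠ v in residual G, v ∈ interior (V j) →
    ∃ w ∈ interior (W i), f (v • x) = w • f x}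
  have hE : ∀ i j, BaireMeasurableSet (E i j) := fun i j =>
    baireMeasurableSet_forall_residual
      (baireMeasurableSet_smul_relation hmeas isOpen_interior) isOpen_interior
  choose O hO hEO using fun i j => (hE i j).residualEq_isOpen
  have h1 : ∀ i, ∀ᶠ x in residual X, x ∈ ⋃ j, E i j := by
    intro i
    refine eventually_residual_of_smul (G := G) (BaireMeasurableSet.iUnion (hE i)) ?_
    filter_upwards [eventually_locally_controlled hmeas hf
      (interior_mem_nhds.2 (hW.1.mem_of_mem trivial : W i ∈ 𝓝 1))] with x hx
    filter_upwards [hx] with g ⟨V', hV', hg⟩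
    obtain ⟨j, -, hj⟩ := hV.1.mem_iff.1 hV'
    refine mem_iUnion.2 ⟨j, ?_⟩
    change ∀ᶠ v in residual G, _
    filter_upwards [hg] with v hv hvj
    exact hv (hj (interior_subset hvj))
  have h2 : ∀ᶠ x in residual X, x ∈ C₀ ∧ ∀ i, x ∈ (⋃ j, E i j) ∧ ∀ j, (x ∈ E i j ↔ x ∈ O i j) :=
    (show ∀ᶠ x in residual X, x ∈ C₀ from hC₀).and <| eventually_countable_forall.2 fun i =>
      (h1 i).and <| eventually_countable_forall.2 fun j => eventuallyEq_set.1 (hEO i j)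
  obtain ⟨C, hC, hCG, hCd⟩ := mem_residual.1 h2
  -- On `C` each `E i j` is relatively open, so the `V j` that works at `x₀` works for all nearby
  -- points of `C`.
  refine ⟨C, residual_of_dense_Gδ hCG hCd, hCG, hfC₀.mono fun x hx => (hC hx).1, ?_⟩
  intro W' hW' x₀ hx₀
  obtain ⟨i, -, hi⟩ := hW.1.mem_iff.1 hW'
  obtain ⟨j, hj⟩ := mem_iUnion.1 ((hC hx₀).2 i).1
  refine ⟨O i j, (hO i j).mem_nhds ((((hC hx₀).2 i).2 j).1 hj), interior (V j),
    interior_mem_nhds.2 (hV.1.mem_of_mem trivial), ?_⟩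
  rintro x ⟨hxC, hxO⟩
  have hx : x ∈ E i j := (((hC hxC).2 i).2 j).2 hxO
  filter_upwards [hx] with v hv hvV
  obtain ⟨w, hw, h⟩ := hv hvV
  exact ⟨w, hi (interior_subset hw), h⟩

end Homomorphism

end BeckerGame

namespace BeckerGame

open TopologicalSpace Filter Topology Set

/-! ### Strategies from invariants. -/

section Game

variable {G X : Type*} [Group G] [TopologicalSpace G] [TopologicalSpace X]

theorem Strategy.prodUpTo_play_congr {x : X} (σ : Strategy G x)
    {m m' : ℕ → Move G x} {n : ℕ}
    (h : ∀ i < n, m i = m' i) : prodUpTo (σ.play m) n = prodUpTo (σ.play m') n := by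
  induction n with
  | zero => rfl
  | succ n ih =>
    rw [prodUpTo, prodUpTo, ih fun i hi => h i (by omega)]
    congr 1
    exact congrArg (σ n) (funext fun i => h i i.isLt)

variable [MulAction G X]

/-- Player II wins `Emb(x, y)` if she can maintain a suitable property of the product
`g_n ⋯ g_0` of her moves. -/
theorem BeckerEmbeddable.of_invariant {x y : X} (Inv : ℕ → (ℕ → Move G x) → G → Prop)
    (hcongr : ∀ n m m' p, (∀ i ≤ n, m i = m' i) → Inv n m p → Inv n m' p)
    (hzero : ∀ m, ∃ p, Inv 0 m p)
    (hsucc : ∀ n m p, Inv n m p → ∃ p', p' * p⁻¹ ∈ (m n).2 ∧ Inv (n + 1) m p')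
    (hU : ∀ n m p, Inv n m p → p • y ∈ (m n).1) : BeckerEmbeddable G x y := by
  choose p₀ hp₀ using hzero
  choose! nxt hnxt using hsucc
  -- Freezing the run after move `n` makes the choices depend only on moves already played.
  let trunc : ℕ → (ℕ → Move G x) → ℕ → Move G x := fun n m i => m (min i n)
  have htrunc : ∀ n m m', (∀ i ≤ n, m i = m' i) → trunc n m = trunc n m' := fun n m m' h =>
    funext fun i => h _ (min_le_right _ _)
  have htrunc_eq : ∀ n m, ∀ i ≤ n, trunc n m i = m i := fun n m i hi => by simp [trunc, hi]
  let S : ℕ → (ℕ → Move G x) → G := fun n m =>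
    Nat.rec (p₀ (trunc 0 m)) (fun k p => nxt k (trunc (k + 1) m) p) n
  have hS : ∀ n m m', (∀ i ≤ n, m i = m' i) → S n m = S n m' := by
    intro n
    induction n with
    | zero => exact fun m m' h => congrArg p₀ (htrunc 0 m m' h)
    | succ n ih =>
      intro m m' h
      change nxt n (trunc (n + 1) m) (S n m) = nxt n (trunc (n + 1) m') (S n m')
      rw [htrunc _ m m' h, ih m m' fun i hi => h i (by omega)]
  have hstep : ∀ n m, Inv n m (S n m) →
      S (n + 1) m * (S n m)⁻¹ ∈ (m n).2 ∧ Inv (n + 1) m (S (n + 1) m) := by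
    intro n m h
    obtain ⟨h1, h2⟩ := hnxt n (trunc (n + 1) m) (S n m)
      (hcongr n _ _ _ (fun i hi => (htrunc_eq (n + 1) m i (by omega)).symm) h)
    rw [htrunc_eq _ _ _ (by omega)] at h1
    exact ⟨h1, hcongr _ _ _ _ (htrunc_eq (n + 1) m) h2⟩
  have hInv : ∀ n m, Inv n m (S n m) := by
    intro n m
    induction n with
    | zero => exact hcongr _ _ _ _ (htrunc_eq 0 m) (hp₀ _)
    | succ n ih => exact (hstep n m ih).2
  let ext : (n : ℕ) → (Fin (n + 1) → Move G x) → ℕ → Move G x := fun n q i => q ⟨min i n, by omega⟩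
  let σ : Strategy G x := fun n q => match n, q with
    | 0, q => S 0 (ext 0 q)
    | n + 1, q => S (n + 1) (ext (n + 1) q) * (S n (ext (n + 1) q))⁻¹
  have hplay0 : ∀ m, σ.play m 0 = S 0 m := fun m => hS 0 _ _ (htrunc_eq 0 m)
  have hplay : ∀ m n, σ.play m (n + 1) = S (n + 1) m * (S n m)⁻¹ := by
    intro m n
    change S (n + 1) (trunc (n + 1) m) * (S n (trunc (n + 1) m))⁻¹ = _
    rw [hS (n + 1) _ m (htrunc_eq _ m), hS n _ m fun i hi => htrunc_eq _ m i (by omega)]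
  have hprod : ∀ m n, prodUpTo (σ.play m) (n + 1) = S n m := by
    intro m n
    induction n with
    | zero => simp [prodUpTo, hplay0]
    | succ n ih => rw [prodUpTo, ih, hplay, inv_mul_cancel_right]
  refine ⟨σ, fun m => ⟨fun n => ?_, fun n => ?_⟩⟩
  · cases n with
    | zero => exact mem_univ _
    | succ n =>
      rw [hplay]
      exact (hstep n m (hInv n m)).1
  · rw [hprod]
    exact hU _ _ _ (hInv n m)

end Game

/-! ### Transfer of winning strategies along `f`. -/

section Homomorphism

variable {G H X Y : Type*}
    [Group G] [TopologicalSpace G] [IsTopologicalGroup G]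
    [Group H] [TopologicalSpace H]
    [TopologicalSpace X] [MulAction G X]
    [TopologicalSpace Y] [MulAction H Y]

/-- A set `C` on which `f` is continuous and continuous along orbits. -/
structure OrbitContinuousOn (G H : Type*) {X Y : Type*} [Group G] [TopologicalSpace G] [Group H]
    [TopologicalSpace H] [TopologicalSpace X] [MulAction G X] [TopologicalSpace Y] [MulAction H Y]
    (f : X → Y) (C : Set X) : Prop where
  continuousOn : ContinuousOn f C
  exists_nhds : ∀ W ∈ 𝓝 (1 : H), ∀ x₀ ∈ C, ∃ U ∈ 𝓝 x₀, ∃ V ∈ 𝓝 (1 : G), ∀ x ∈ C ∩ U,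
    ∀ᶠ v in residual G, v ∈ V → ∃ w ∈ W, f (v • x) = w • f x

/-- Translates a move at `f x` into one at `x`. The form `a * b * c⁻¹` fits the step between
perturbed positions: new perturbation, Player II's move, old perturbation undone. -/
theorem OrbitContinuousOn.exists_move {f : X → Y} {C : Set X} (hC : OrbitContinuousOn G H f C)
    {x : X} (hx : x ∈ C) (M : Move H (f x)) : ∃ N : Move G x,
      (∀ z ∈ C, z ∈ N.1 → f z ∈ M.1) ∧ ∀ z ∈ C, z ∈ N.1 → ∀ᶠ v in residual G,
        (∃ a ∈ N.2, ∃ b ∈ N.2, ∃ c ∈ N.2, v = a * b * c⁻¹) → ∃ w ∈ M.2, f (v • z) = w • f z := by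
  obtain ⟨U, hU, V, hV, h⟩ := hC.exists_nhds M.2 (M.2.isOpen.mem_nhds M.2.mem) x hx
  obtain ⟨U', hU', hfU⟩ := mem_nhdsWithin_iff_exists_mem_nhds_inter.1
    (hC.continuousOn x hx (M.1.isOpen.mem_nhds M.1.mem))
  obtain ⟨O, hO, hOo, hxO⟩ := mem_nhds_iff.1 (inter_mem hU hU')
  have hcont : Tendsto (fun t : G × G × G => t.1 * t.2.1 * t.2.2⁻¹) (𝓝 (1, 1, 1)) (𝓝 1) := by
    have : Continuous fun t : G × G × G => t.1 * t.2.1 * t.2.2⁻¹ := by fun_prop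
    simpa using this.tendsto (1, 1, 1)
  have hV' := hcont hV
  rw [nhds_prod_eq, nhds_prod_eq, mem_map, mem_prod_iff] at hV'
  obtain ⟨A, hA, B, hB, hAB⟩ := hV'
  obtain ⟨B₁, hB₁, B₂, hB₂, hB'⟩ := mem_prod_iff.1 hB
  obtain ⟨Q, hQ, hQo, h1Q⟩ := mem_nhds_iff.1 (inter_mem hA (inter_mem hB₁ hB₂))
  refine ⟨(⟨⟨O, hOo⟩, hxO⟩, ⟨⟨Q, hQo⟩, h1Q⟩), fun z hz hzO => hfU ⟨(hO hzO).2, hz⟩,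
    fun z hz hzO => ?_⟩
  filter_upwards [h z ⟨hz, (hO hzO).1⟩] with v hv
  rintro ⟨a, ha, b, hb, c, hc, rfl⟩
  exact hv (hAB (show (a, b, c) ∈ A ×ˢ B from ⟨(hQ ha).1, hB' ⟨(hQ hb).2.1, (hQ hc).2.2⟩⟩))

theorem OrbitContinuousOn.beckerEmbeddable [BaireSpace G] [ContinuousSMul G X] {f : X → Y} (hf : IsOrbitHom G H f) {C : Set X}
    (hC : OrbitContinuousOn G H f C) {x y : X} (hx : x ∈ C)
    (hy : ∀ᶠ g in residual G, g • y ∈ C) (hxy : BeckerEmbeddable G x y) :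
    BeckerEmbeddable H (f x) (f y) := by
  obtain ⟨σ, hσ⟩ := hxy
  choose T hTU hTV using hC.exists_move hx
  let P : ℕ → (ℕ → Move H (f x)) → G := fun n m => prodUpTo (σ.play fun i => T (m i)) (n + 1)
  have hP : ∀ n m, P n m • y ∈ (T (m n)).1 := fun n m => (hσ fun i => T (m i)).2 n
  have hnear : ∀ n m (A : Set G), IsOpen A → (1 : G) ∈ A → ∀ q : G → Prop,
      (∀ᶠ k in residual G, q k) → ∃ k ∈ (T (m n)).2, k ∈ A ∧ q k ∧
        (k * P n m) • y ∈ C ∧ (k * P n m) • y ∈ (T (m n)).1 := by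
    intro n m A hA h1 q hq
    have hopen : IsOpen (((T (m n)).2 : Set G) ∩ (A ∩
        (fun k : G => (k * P n m) • y) ⁻¹' ((T (m n)).1 : Set X))) :=
      (T (m n)).2.isOpen.inter (hA.inter ((T (m n)).1.isOpen.preimage (by fun_prop)))
    obtain ⟨k, ⟨hk1, hk2, hk3⟩, hk4, hk5⟩ := exists_mem_of_eventually_residual hopen
      ⟨1, (T (m n)).2.mem, h1, by simpa using hP n m⟩
      (hq.and (eventually_residual_mul_right hy (P n m)))
    exact ⟨k, hk1, hk2, hk4, hk5, hk3⟩
  refine BeckerEmbeddable.of_invariant (fun n m h => ∃ k ∈ (T (m n)).2,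
    (k * P n m) • y ∈ C ∧ (k * P n m) • y ∈ (T (m n)).1 ∧ f ((k * P n m) • y) = h • f y)
    ?_ ?_ ?_ ?_
  · intro n m m' h hmm'
    have hPP : P n m = P n m' := σ.prodUpTo_play_congr fun i hi => by rw [hmm' i (by omega)]
    rw [hPP, hmm' n le_rfl]
    exact id
  · intro m
    obtain ⟨k, hk, -, -, hkC, hkU⟩ := hnear 0 m univ isOpen_univ trivial (fun _ => True)
      (Eventually.of_forall fun _ => trivial)
    obtain ⟨h, hh⟩ : ∃ h : H, h • f y = f ((k * P 0 m) • y) := hf _ y ⟨_, rfl⟩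
    exact ⟨h, k, hk, hkC, hkU, hh.symm⟩
  · rintro n m h ⟨k, hk, hkC, hkU, hkh⟩
    let g : G := σ.play (fun i => T (m i)) (n + 1)
    have hg : g ∈ (T (m n)).2 := (hσ fun i => T (m i)).1 (n + 1)
    have hPg : P (n + 1) m = g * P n m := rfl
    -- `k'` must be small for move `n`, which governs the present step, and for move `n + 1`, which
    -- governs the next.
    obtain ⟨k', hk', hk'V, hq, hk'C, hk'U⟩ := hnear (n + 1) m (T (m n)).2 (T (m n)).2.isOpen
      (T (m n)).2.mem _
      (eventually_residual_mul_right (hTV (m n) _ hkC hkU) (g * k⁻¹))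
    obtain ⟨w, hw, hwf⟩ := hq ⟨k', hk'V, g, hg, k, hk, by group⟩
    have hmul : (k' * (g * k⁻¹)) • (k * P n m) • y = (k' * P (n + 1) m) • y := by
      rw [hPg, smul_smul]
      congr 1
      group
    rw [hmul, hkh, smul_smul] at hwf
    exact ⟨w * h, by simpa using hw, k', hk', hk'C, hk'U, hwf⟩
  · rintro n m h ⟨k, hk, hkC, hkU, hkh⟩
    rw [← hkh]
    exact hTU _ _ hkC hkU

end Homomorphism

end BeckerGame

theorem mainTheorem2 {G H X Y : Type*}
    [Group G] [TopologicalSpace G] [IsTopologicalGroup G] [PolishSpace G]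
    [Group H] [TopologicalSpace H] [IsTopologicalGroup H] [PolishSpace H]
    [TopologicalSpace X] [PolishSpace X] [MulAction G X] [ContinuousSMul G X]
    [TopologicalSpace Y] [PolishSpace Y] [MulAction H Y] [ContinuousSMul H Y]
    (f : X → Y) (hmeas : BeckerGame.BaireMeasurable f) (hf : BeckerGame.IsOrbitHom G H f) :
    ∃ X₀ : Set X,
      (∀ (g : G), ∀ x ∈ X₀, g • x ∈ X₀) ∧ Dense X₀ ∧ IsGδ X₀ ∧
      (∀ x ∈ X₀, ∀ y ∈ X₀,
        BeckerGame.BeckerEmbeddable G x y → BeckerGame.BeckerEmbeddable H (f x) (f y)) ∧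
      BeckerGame.IsDigraphHom (BeckerGame.beckerDigraphOn G X₀) (BeckerGame.beckerDigraph H Y)
        (fun o : BeckerGame.orbitsOf G X₀ => hf.orbitMap o.1) := by
  obtain ⟨C, hC, hCG, hfC, hCW⟩ := BeckerGame.exists_orbit_continuity hmeas hf
  have hemb : ∀ x ∈ {x : X | ∀ᶠ g in residual G, g • x ∈ C},
      ∀ y ∈ {x : X | ∀ᶠ g in residual G, g • x ∈ C},
        BeckerGame.BeckerEmbeddable G x y → BeckerGame.BeckerEmbeddable H (f x) (f y) := by
    intro x hx y hy hxy
    -- `x` itself need not lie in `C`; some translate does, and embeddability depends only on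
    -- orbits.
    obtain ⟨g, -, hg⟩ := BeckerGame.exists_mem_of_eventually_residual isOpen_univ
      Set.univ_nonempty hx
    have h := BeckerGame.OrbitContinuousOn.beckerEmbeddable hf ⟨hfC, hCW⟩ hg hy
      (by simpa using hxy.smul G g 1)
    rwa [BeckerGame.beckerEmbeddable_congr H (hf (g • x) x ⟨g, rfl⟩)
      ((MulAction.orbitRel H Y).refl (f y))] at h
  refine ⟨{x | ∀ᶠ g in residual G, g • x ∈ C}, ?_, ?_, ?_, hemb, ?_⟩
  · intro g x hx
    have := BeckerGame.eventually_residual_mul_right hx g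
    simpa [mul_smul] using this
  · exact dense_of_mem_residual (BeckerGame.eventually_residual_prod
      (BeckerGame.eventually_residual_smul (p := (· ∈ C)) hC))
  · exact BeckerGame.isGδ_eventually_smul_mem hCG
  · rintro ⟨_, x, hx, rfl⟩ ⟨_, y, hy, rfl⟩ h
    exact hemb x hx y hy h
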